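/- For a finite set $P\subset\mathbb{R}^d$ let $\mathcal{R}(P)$ be the set of all distinct subsets of $P$ of the form $B\cap P$ with $B$ an axis-parallel box, and for weights $x\in\mathbb{Z}^P$ and $R\in\mathcal{R}(P)$ let $R(x)=\sum_{p\in R}x_p$. The average squared error of a vector of answers $y\in\mathbb{R}^{\mathcal{R}(P)}$ is $\frac{1}{|\mathcal{R}(P)|}\sum_{R\in\mathcal{R}(P)}(y_R-R(x))^2$. Let $U\subseteq\mathbb{Z}$ with $\{0,1\}\subseteq U$ (for instance $U=\{0,1\}$ or $U=\mathbb{Z}$), and let $d=d(n)\in\mathbb{N}$ with $d(n)=\Theta(\log n)$. A mechanism $\mathcal{M}$ over $U$ for orthogonal range counting assigns to every $n$, every (public) set $P\subset\mathbb{R}^{d(n)}$ with $|P|=n$ and every weight vector $x\in U^P$ a random vector $\mathcal{M}_P(x)\in\mathbb{R}^{\mathcal{R}(P)}$. It is $(\varepsilon,\delta)$-differentially private if for all $n$ and all such $P$, all $x,x'\in U^P$ with $\|x-x'\|_1\le 1$ and all measurable $S\subseteq\mathbb{R}^{\mathcal{R}(P)}$, $\Pr[\mathcal{M}_P(x)\in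 S]\le e^{\varepsilon}\Pr[\mathcal{M}_P(x')\in S]+\delta$. Theorem. Let $\gamma,\varepsilon,\delta$ be constants with $\varepsilon\ge 0$ and $0\le\delta<\gamma$. Suppose that $\mathcal{M}$ answers orthogonal range counting with average squared error $n^{o(1)}$ with probability at least $\gamma$; that is, there is a function $g$ with $g(n)\to 0$ as $n\to\infty$ such that for all sufficiently large $n$, every $P\subset\mathbb{R}^{d(n)}$ with $|P|=n$ and every $x\in U^P$, the average squared error of $\mathcal{M}_P(x)$ is at most $n^{g(n)}$ with probability at least $\gamma$. Then $\mathcal{M}$ is not $(\varepsilon,\delta)$-differentially private. -/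

import Mathlib

open Filter Topology MeasureTheory Asymptotics

namespace PrivateRangeCounting

/-- The range space of the orthogonal range counting problem on a finite point set `P ⊆ ℝᵈ`: all
distinct subsets of `P` of the form `B ∩ P`, where `B = ∏ᵢ [aᵢ, bᵢ]` is an axis-parallel box. -/
noncomputable def orthogonalRanges {d : ℕ} (P : Finset (Fin d → ℝ)) :
    Finset (Finset (Fin d → ℝ)) :=
  open Classical in
  P.powerset.filter fun R => ∃ a b : Fin d → ℝ, (R : Set (Fin d → ℝ)) = Set.Icc a b ∩ P

/-- The range count `R(x) = ∑_{p ∈ R} x_p` of the range `R` for the weights `x ∈ Uᴾ`, `U ⊆ ℤ`. -/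
noncomputable def rangeCount {d : ℕ} {P : Finset (Fin d → ℝ)} {U : Set ℤ}
    (R : Finset (Fin d → ℝ)) (x : P → U) : ℝ :=
  open Classical in
  ∑ p : P, if (p : Fin d → ℝ) ∈ R then ((x p : ℤ) : ℝ) else 0

/-- The average squared error `(1/|𝓡|) ∑_{R ∈ 𝓡} (y_R - R(x))²` of the answers `y` to all
orthogonal range counting queries on `P` with weights `x`. -/
noncomputable def avgSquaredError {d : ℕ} {P : Finset (Fin d → ℝ)} {U : Set ℤ}
    (x : P → U) (y : orthogonalRanges P → ℝ) : ℝ :=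
  (∑ R : orthogonalRanges P, (y R - rangeCount (R : Finset (Fin d → ℝ)) x) ^ 2) /
    ((orthogonalRanges P).card : ℝ)

/-- `(ε, δ)`-differential privacy of a randomized map `M`, given by its output laws, whose inputs
are the vectors indexed by `ι` with entries in `U ⊆ ℤ`:
`Pr[M(x) ∈ S] ≤ e^ε Pr[M(x') ∈ S] + δ` whenever `‖x - x'‖₁ ≤ 1` and `S` is measurable. -/
def IsDifferentiallyPrivate {ι Y : Type*} [Fintype ι] [MeasurableSpace Y] {U : Set ℤ}
    (M : (ι → U) → ProbabilityMeasure Y) (ε δ : ℝ) : Prop :=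
  ∀ x x' : ι → U, (∑ i, |(x i : ℤ) - (x' i : ℤ)|) ≤ 1 →
    ∀ S : Set Y, MeasurableSet S →
      (M x : Measure Y).real S ≤ Real.exp ε * (M x' : Measure Y).real S + δ

/-- A mechanism over `U` for orthogonal range counting in dimension `d = d(n)`: for every `n` and
every finite (public) point set `P ⊆ ℝ^{d(n)}`, a map from weight vectors `x ∈ Uᴾ` to (laws of)
random vectors of answers in `ℝ^𝓡`, where `𝓡` is the set of orthogonal ranges of `P`.
Only the point sets `P` with `|P| = n` matter below. -/
abbrev Mechanism (U : Set ℤ) (d : ℕ → ℕ) : Type :=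
  (n : ℕ) → (P : Finset (Fin (d n) → ℝ)) →
    (P → U) → ProbabilityMeasure (orthogonalRanges P → ℝ)

/-- The mechanism is `(ε, δ)`-differentially private: all its maps, for every `n` and every point
set of size `n`, are. -/
def Mechanism.IsPrivate {U : Set ℤ} {d : ℕ → ℕ} (M : Mechanism U d) (ε δ : ℝ) : Prop :=
  ∀ (n : ℕ) (P : Finset (Fin (d n) → ℝ)), P.card = n → IsDifferentiallyPrivate (M n P) ε δ

/-- For all large `n`, every `n`-point set `P ⊆ ℝ^{d(n)}` and all weights `x`, the mechanism has
average squared error at most `err n` with probability at least `γ`. -/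
def Mechanism.ApproximatesWithin {U : Set ℤ} {d : ℕ → ℕ} (M : Mechanism U d)
    (err : ℕ → ℝ) (γ : ℝ) : Prop :=
  ∀ᶠ n in atTop, ∀ P : Finset (Fin (d n) → ℝ), P.card = n → ∀ x : P → U,
    γ ≤ (M n P x : Measure (orthogonalRanges P → ℝ)).real {y | avgSquaredError x y ≤ err n}

end PrivateRangeCounting

/-! The hard point sets are grids `{0,1}^m × {0, …, t-1}`, with private bits only on the points of
even parity. Write `F` for `boxSumSq`. On the cube, `F` is the quadratic form of the `m`-th tensor
power of a `2 × 2` matrix with eigenvalues 3 and 1, so its eigenvalues are `3 ^ k`. Multiplication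
by the parity character exchanges `3 ^ k` with `3 ^ (m - k)`. A vector supported on even points is
fixed by this, so `F` is at least `√3 ^ m` times its squared norm (`boxSumSq_cube`). The line
contributes a further factor `t / 8` (`boxSumSq_prod_line`).

There are at most about `3 ^ m * t ^ 2` ranges. Two inputs sharing an output with error `E`
therefore differ in `O(E * √3 ^ m * t)` bits (`hammingDist_le_of_avgSquaredError_le`). As `√3 < 2`,
this is a vanishing fraction of the `2 ^ m * t / 2` bits when `E` grows slowly, so accurate answers
reveal almost all bits, which privacy forbids (`reconstruction_bound`).

The line has length `t = 2 ^ (a * m)`: this makes `m` a small multiple of `log n`, so that the grid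
fits into dimension `d n`. -/

namespace PrivateRangeCounting

/-! ### Quadratic form of interval sums -/

/-- The sum of the squares of the sums of `z` over all intervals of a finite preorder. -/
noncomputable def boxSumSq {β : Type*} [Fintype β] [Preorder β] (z : β → ℝ) : ℝ :=
  open Classical in
  ∑ l, ∑ u, (∑ p, if l ≤ p ∧ p ≤ u then z p else 0) ^ 2

theorem boxSumSq_neg {β : Type*} [Fintype β] [Preorder β] (z : β → ℝ) :
    boxSumSq (fun p => -z p) = boxSumSq z := by
  classical
  unfold boxSumSq
  refine Finset.sum_congr rfl fun l _ => Finset.sum_congr rfl fun u _ => ?_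
  rw [← neg_sq, ← Finset.sum_neg_distrib]
  congr 1
  refine Finset.sum_congr rfl fun p _ => ?_
  split_ifs <;> simp

theorem boxSumSq_comp_orderIso {β β' : Type*} [Fintype β] [Preorder β] [Fintype β'] [Preorder β']
    (e : β ≃o β') (z : β' → ℝ) : boxSumSq (fun p => z (e p)) = boxSumSq z := by
  classical
  unfold boxSumSq
  refine Fintype.sum_equiv e.toEquiv _ _ fun l => Fintype.sum_equiv e.toEquiv _ _ fun u => ?_
  congr 1
  refine Fintype.sum_equiv e.toEquiv _ _ fun p => ?_
  simp

/-- The three summands are the three nonempty intervals of `Bool`. -/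
theorem boxSumSq_bool_prod {β : Type*} [Fintype β] [Preorder β] (z : Bool × β → ℝ) :
    boxSumSq z = boxSumSq (fun p => z (false, p)) + boxSumSq (fun p => z (true, p)) +
      boxSumSq (fun p => z (false, p) + z (true, p)) := by
  classical
  simp only [boxSumSq, Fintype.sum_prod_type, Fintype.sum_bool, Prod.mk_le_mk]
  have htf : ¬ (true ≤ false) := by decide
  simp only [le_refl, Bool.false_le, true_and, htf, false_and, and_false, if_false,
    Finset.sum_const_zero, add_zero, zero_add, ne_eq, OfNat.ofNat_ne_zero, not_false_eq_true,
    zero_pow]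
  simp only [← Finset.sum_add_distrib]
  refine Finset.sum_congr rfl fun l _ => Finset.sum_congr rfl fun u _ => ?_
  have : ∀ p, (if l ≤ p ∧ p ≤ u then z (false, p) + z (true, p) else 0) =
      (if l ≤ p ∧ p ≤ u then z (false, p) else 0) + (if l ≤ p ∧ p ≤ u then z (true, p) else 0) := by
    intro p; split_ifs <;> ring
  simp only [this, Finset.sum_add_distrib]
  ring

/-- Parallelogram law for a quadratic form. -/
theorem boxSumSq_add_sub {β : Type*} [Fintype β] [Preorder β] (v w : β → ℝ) :
    boxSumSq (fun p => v p + w p) + boxSumSq (fun p => v p - w p) =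
      2 * (boxSumSq v + boxSumSq w) := by
  classical
  simp only [boxSumSq, ← Finset.sum_add_distrib, Finset.mul_sum]
  refine Finset.sum_congr rfl fun l _ => Finset.sum_congr rfl fun u _ => ?_
  have h₁ : ∀ p, (if l ≤ p ∧ p ≤ u then v p + w p else 0) =
      (if l ≤ p ∧ p ≤ u then v p else 0) + (if l ≤ p ∧ p ≤ u then w p else 0) := by
    intro p; split_ifs <;> ring
  have h₂ : ∀ p, (if l ≤ p ∧ p ≤ u then v p - w p else 0) =
      (if l ≤ p ∧ p ≤ u then v p else 0) - (if l ≤ p ∧ p ≤ u then w p else 0) := by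
    intro p; split_ifs <;> ring
  simp only [h₁, h₂, Finset.sum_add_distrib, Finset.sum_sub_distrib]
  ring

/-! ### Parity and the lower bound on the cube -/

/-- The parity character of the Boolean cube. -/
def paritySign {m : ℕ} (p : Fin m → Bool) : ℝ := ∏ i, if p i then -1 else 1

theorem paritySign_eq_or {m : ℕ} (p : Fin m → Bool) : paritySign p = 1 ∨ paritySign p = -1 := by
  unfold paritySign
  refine Finset.prod_induction _ (fun r : ℝ => r = 1 ∨ r = -1) ?_ (Or.inl rfl) ?_
  · rintro a b (rfl | rfl) (rfl | rfl) <;> norm_num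
  · intro i _
    split_ifs <;> simp

theorem sum_paritySign {m : ℕ} (hm : 0 < m) : ∑ p : Fin m → Bool, paritySign p = 0 := by
  have h := Finset.prod_univ_sum (fun _ : Fin m => (Finset.univ : Finset Bool))
    (fun _ b => if b then (-1 : ℝ) else 1)
  simp only [Fintype.piFinset_univ] at h
  unfold paritySign
  rw [← h]
  simp [hm.ne']

theorem card_paritySign_eq_one {m : ℕ} (hm : 0 < m) :
    2 * Nat.card {p : Fin m → Bool // paritySign p = 1} = 2 ^ m := by
  classical
  have h : ∀ p : Fin m → Bool, paritySign p + 1 = if paritySign p = 1 then 2 else 0 := by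
    intro p
    rcases paritySign_eq_or p with h | h <;> rw [h] <;> norm_num
  have hs : ∑ p : Fin m → Bool, (paritySign p + 1) = 2 ^ m := by
    rw [Finset.sum_add_distrib, sum_paritySign hm]
    simp
  simp only [h] at hs
  rw [← Finset.sum_filter, Finset.sum_const, nsmul_eq_mul] at hs
  rw [Nat.card_eq_fintype_card, Fintype.card_subtype]
  have : ((2 * (Finset.univ.filter fun p : Fin m → Bool => paritySign p = 1).card : ℕ) : ℝ) =
      ((2 ^ m : ℕ) : ℝ) := by
    push_cast
    linarith
  exact_mod_cast this

/-- The weights `a`, `b` make the induction close. With `z₀`, `z₁` the two halves of `z` and `χ` the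
parity, `F(z) = (3 F(z₀ + z₁) + F(z₀ - z₁)) / 2`, whereas for `χ z` the factors 3 and 1 are
exchanged, because `χ` changes sign on the second half. -/
theorem boxSumSq_cube_weighted (m : ℕ) : ∀ (a b : ℝ), 0 ≤ a → 0 ≤ b → ∀ z : (Fin m → Bool) → ℝ,
    2 * (a * b) * √3 ^ m * ∑ p, z p ^ 2 ≤
      a ^ 2 * boxSumSq z + b ^ 2 * boxSumSq (fun p => paritySign p * z p) := by
  induction m with
  | zero =>
    intro a b _ _ z
    simp only [boxSumSq, paritySign, Fintype.sum_unique]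
    simp
    nlinarith [mul_nonneg (sq_nonneg (a - b)) (sq_nonneg (z default))]
  | succ m ih =>
    intro a b ha hb z
    let e : Bool × (Fin m → Bool) ≃o (Fin (m + 1) → Bool) := Fin.consOrderIso (fun _ => Bool)
    have he : ∀ c p, e (c, p) = Fin.cons c p := fun c p => rfl
    set z₀ : (Fin m → Bool) → ℝ := fun p => z (e (false, p)) with hz₀
    set z₁ : (Fin m → Bool) → ℝ := fun p => z (e (true, p)) with hz₁
    have hs₀ : ∀ p : Fin m → Bool, paritySign (e (false, p)) = paritySign p := by
      intro p; simp [he, paritySign, Fin.prod_univ_succ]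
    have hs₁ : ∀ p : Fin m → Bool, paritySign (e (true, p)) = -paritySign p := by
      intro p; simp [he, paritySign, Fin.prod_univ_succ]
    have h₁ := boxSumSq_bool_prod (fun p => z (e p))
    rw [boxSumSq_comp_orderIso e] at h₁
    have h₂ := boxSumSq_bool_prod (fun p => paritySign (e p) * z (e p))
    rw [boxSumSq_comp_orderIso e (fun p => paritySign p * z p)] at h₂
    simp only [hs₀, hs₁] at h₂
    have hn := boxSumSq_neg (fun p => paritySign p * z₁ p)
    have hn' : (fun p => paritySign p * z₀ p - paritySign p * z₁ p) =
        fun p => paritySign p * (z₀ p - z₁ p) := by ext p; ring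
    have hn'' : (fun p => paritySign p * z₀ p + paritySign p * z₁ p) =
        fun p => paritySign p * (z₀ p + z₁ p) := by ext p; ring
    have h₃ : boxSumSq (fun p => paritySign p * z p) = boxSumSq (fun p => paritySign p * z₀ p) +
        boxSumSq (fun p => paritySign p * z₁ p) +
        boxSumSq (fun p => paritySign p * (z₀ p - z₁ p)) := by
      rw [h₂, ← hn, ← hn']
      congr 2
      · simp [hz₁]
      · ext p
        simp [hz₁, hz₀]
        ring
    have h₄ := boxSumSq_add_sub z₀ z₁
    have h₅ := boxSumSq_add_sub (fun p => paritySign p * z₀ p) (fun p => paritySign p * z₁ p)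
    rw [hn', hn''] at h₅
    have hsum : ∑ p, z p ^ 2 = ∑ p, z₀ p ^ 2 + ∑ p, z₁ p ^ 2 := by
      rw [← e.toEquiv.sum_comp, Fintype.sum_prod_type, Fintype.sum_bool, add_comm]
      rfl
    have hpar : ∑ p, (z₀ p + z₁ p) ^ 2 + ∑ p, (z₀ p - z₁ p) ^ 2 = 2 * ∑ p, z p ^ 2 := by
      rw [hsum, ← Finset.sum_add_distrib, ← Finset.sum_add_distrib, Finset.mul_sum]
      refine Finset.sum_congr rfl fun p _ => ?_
      ring
    -- The factor 3 is absorbed into `a` for the sum and into `b` for the difference; either way the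
    -- product of the weights becomes `√3 * a * b`.
    have i₁ := ih (√3 * a) b (by positivity) hb (fun p => z₀ p + z₁ p)
    have i₂ := ih a (√3 * b) ha (by positivity) (fun p => z₀ p - z₁ p)
    have h3 : √3 ^ 2 = (3 : ℝ) := Real.sq_sqrt (by norm_num)
    rw [mul_pow, h3] at i₁ i₂
    have key : 2 * (√3 * a * b) * √3 ^ m * ∑ p, (z₀ p + z₁ p) ^ 2 +
        2 * (a * (√3 * b)) * √3 ^ m * ∑ p, (z₀ p - z₁ p) ^ 2 =
        2 * (2 * (a * b) * √3 ^ (m + 1) * ∑ p, z p ^ 2) := by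
      rw [pow_succ]
      linear_combination 2 * (√3 * a * b) * √3 ^ m * hpar
    rw [h₃]
    rw [h₁]
    linear_combination (1 / 2) * i₁ + (1 / 2) * i₂ - (1 / 2) * key
      + (1 / 2) * a ^ 2 * h₄ + (1 / 2) * b ^ 2 * h₅

theorem boxSumSq_cube {m : ℕ} (z : (Fin m → Bool) → ℝ) (hz : ∀ p, paritySign p ≠ 1 → z p = 0) :
    √3 ^ m * ∑ p, z p ^ 2 ≤ boxSumSq z := by
  have h := boxSumSq_cube_weighted m 1 1 zero_le_one zero_le_one z
  have hz' : (fun p => paritySign p * z p) = z := by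
    ext p
    by_cases hp : paritySign p = 1
    · rw [hp, one_mul]
    · rw [hz p hp, mul_zero]
  rw [hz'] at h
  linarith

/-! ### The line and products with it -/

theorem sum_sq_sub_range (S : ℕ → ℝ) (t : ℕ) :
    ∑ i ∈ Finset.range (t + 1), ∑ j ∈ Finset.range (t + 1), (S i - S j) ^ 2 =
      2 * ∑ b ∈ Finset.range t, ∑ a ∈ Finset.range (b + 1), (S (b + 1) - S a) ^ 2 := by
  induction t with
  | zero => simp
  | succ t ih =>
    rw [Finset.sum_range_succ (n := t + 1)]
    simp only [Finset.sum_range_succ (n := t + 1)]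
    rw [Finset.sum_add_distrib, ih,
      Finset.sum_range_succ (fun b => ∑ a ∈ Finset.range (b + 1), (S (b + 1) - S a) ^ 2)]
    have : ∑ i ∈ Finset.range (t + 1), (S i - S (t + 1)) ^ 2 =
        ∑ i ∈ Finset.range (t + 1), (S (t + 1) - S i) ^ 2 :=
      Finset.sum_congr rfl fun i _ => by ring
    rw [this]
    ring

/-- Interval sums are differences of the prefix sums `S`, and each `w s` is a difference of two of
these in `t + 1` ways, one for each base point `j`. -/
theorem boxSumSq_line {t : ℕ} (w : Fin t → ℝ) : t * ∑ s, w s ^ 2 ≤ 8 * boxSumSq w := by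
  classical
  let W : ℕ → ℝ := fun i => if h : i < t then w ⟨i, h⟩ else 0
  let S : ℕ → ℝ := fun i => ∑ j ∈ Finset.range i, W j
  have hW : ∀ s : Fin t, w s = W s := fun s => by simp [W]
  have hI : ∀ a b : Fin t, a ≤ b →
      (∑ p, if a ≤ p ∧ p ≤ b then w p else 0) = S (b + 1) - S a := by
    intro a b hab
    rw [← Finset.sum_Ico_eq_sub _ (by have : (a : ℕ) ≤ b := hab; omega)]
    simp only [hW, Fin.le_def]
    rw [Fin.sum_univ_eq_sum_range (fun i => if (a : ℕ) ≤ i ∧ i ≤ b then W i else 0),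
      ← Finset.sum_filter]
    refine Finset.sum_congr ?_ fun _ _ => rfl
    ext i
    simp only [Finset.mem_filter, Finset.mem_range, Finset.mem_Ico]
    omega
  have hF : ∑ b ∈ Finset.range t, ∑ a ∈ Finset.range (b + 1), (S (b + 1) - S a) ^ 2 ≤
      boxSumSq w := by
    unfold boxSumSq
    rw [Finset.sum_comm, ← Fin.sum_univ_eq_sum_range
      (fun b => ∑ a ∈ Finset.range (b + 1), (S (b + 1) - S a) ^ 2)]
    refine Finset.sum_le_sum fun b _ => ?_
    have : ∑ a ∈ Finset.range ((b : ℕ) + 1), (S (b + 1) - S a) ^ 2 =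
        ∑ a : Fin t, if a ≤ b then (S (b + 1) - S a) ^ 2 else 0 := by
      simp only [Fin.le_def]
      rw [Fin.sum_univ_eq_sum_range (fun a => if a ≤ (b : ℕ) then (S (b + 1) - S a) ^ 2 else 0),
        ← Finset.sum_filter]
      refine Finset.sum_congr ?_ fun _ _ => rfl
      ext i
      simp only [Finset.mem_filter, Finset.mem_range]
      omega
    rw [this]
    refine Finset.sum_le_sum fun a _ => ?_
    split_ifs with h
    · rw [← hI a b h]
      refine le_of_eq ?_
      congr!
    · positivity
  have hG := sum_sq_sub_range S t
  set G := ∑ i ∈ Finset.range (t + 1), ∑ j ∈ Finset.range (t + 1), (S i - S j) ^ 2 with hGdef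
  have hshift : ∑ s ∈ Finset.range t, ∑ j ∈ Finset.range (t + 1), (S (s + 1) - S j) ^ 2 ≤ G := by
    rw [hGdef, Finset.sum_range_succ']
    exact le_add_of_nonneg_right (Finset.sum_nonneg fun _ _ => sq_nonneg _)
  have hno : ∑ s ∈ Finset.range t, ∑ j ∈ Finset.range (t + 1), (S s - S j) ^ 2 ≤ G := by
    rw [hGdef, Finset.sum_range_succ _ t]
    exact le_add_of_nonneg_right (Finset.sum_nonneg fun _ _ => sq_nonneg _)
  have hmain : ((t : ℝ) + 1) * ∑ s, w s ^ 2 ≤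
      2 * ∑ s ∈ Finset.range t, ∑ j ∈ Finset.range (t + 1), (S (s + 1) - S j) ^ 2 +
      2 * ∑ s ∈ Finset.range t, ∑ j ∈ Finset.range (t + 1), (S s - S j) ^ 2 := by
    simp only [hW]
    rw [Fin.sum_univ_eq_sum_range (fun i => W i ^ 2)]
    simp only [Finset.mul_sum, ← Finset.sum_add_distrib]
    refine Finset.sum_le_sum fun s _ => ?_
    have : ((t : ℝ) + 1) * W s ^ 2 = ∑ j ∈ Finset.range (t + 1), W s ^ 2 := by simp
    rw [this]
    refine Finset.sum_le_sum fun j _ => ?_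
    have : W s = (S (s + 1) - S j) - (S s - S j) := by
      simp [S, Finset.sum_range_succ]
    rw [this]
    nlinarith [sq_nonneg ((S (s + 1) - S j) + (S s - S j))]
  have : 0 ≤ ∑ s, w s ^ 2 := Finset.sum_nonneg fun _ _ => sq_nonneg _
  nlinarith

/-- For each fixed interval of `β`, `boxSumSq_line` applies to the sums over that interval as a
function on the line. -/
theorem boxSumSq_prod_line {β : Type*} [Fintype β] [Preorder β] {t : ℕ} (z : β × Fin t → ℝ) :
    t * ∑ s, boxSumSq (fun p => z (p, s)) ≤ 8 * boxSumSq z := by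
  classical
  have h : boxSumSq z = ∑ l, ∑ u,
      boxSumSq (fun s : Fin t => ∑ p, if l ≤ p ∧ p ≤ u then z (p, s) else 0) := by
    simp only [boxSumSq, Fintype.sum_prod_type, Prod.mk_le_mk]
    refine Finset.sum_congr rfl fun l _ => ?_
    rw [Finset.sum_comm]
    refine Finset.sum_congr rfl fun u _ => Finset.sum_congr rfl fun a _ =>
      Finset.sum_congr rfl fun b _ => ?_
    congr 1
    rw [Finset.sum_comm]
    refine Finset.sum_congr rfl fun s _ => ?_
    by_cases h : a ≤ s ∧ s ≤ b
    · simp [h]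
    · rw [if_neg h]
      exact Finset.sum_eq_zero fun p _ => if_neg fun hp => h ⟨hp.1.2, hp.2.2⟩
  rw [h]
  simp only [boxSumSq.eq_def (β := β)]
  rw [Finset.sum_comm]
  simp_rw [Finset.sum_comm (s := (Finset.univ : Finset (Fin t)))]
  simp only [Finset.mul_sum]
  refine Finset.sum_le_sum fun l _ => Finset.sum_le_sum fun u _ => ?_
  have := boxSumSq_line (fun s : Fin t => ∑ p, if l ≤ p ∧ p ≤ u then z (p, s) else 0)
  rwa [Finset.mul_sum] at this

theorem boxSumSq_cube_prod_line {m t : ℕ} (z : (Fin m → Bool) × Fin t → ℝ)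
    (hz : ∀ p, paritySign p.1 ≠ 1 → z p = 0) :
    t * (√3 ^ m * ∑ p, z p ^ 2) ≤ 8 * boxSumSq z := by
  refine le_trans ?_ (boxSumSq_prod_line z)
  rw [Fintype.sum_prod_type_right, Finset.mul_sum]
  gcongr with s _
  exact boxSumSq_cube (fun p => z (p, s)) fun p hp => hz (p, s) hp

/-! ### Orthogonal ranges of an embedded lattice -/

section Lattice

variable {α : Type*} [Fintype α] {d : ℕ} (φ : α → Fin d → ℝ)

/-- The image of `φ`, as a finite point set. -/
noncomputable def pointSet : Finset (Fin d → ℝ) :=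
  open Classical in Finset.univ.image φ

theorem mem_pointSet {φ : α → Fin d → ℝ} {x : Fin d → ℝ} : x ∈ pointSet φ ↔ ∃ p, φ p = x := by
  classical
  simp [pointSet]

/-- The indexing of the points of `pointSet φ`. -/
noncomputable def pointEquiv {φ : α → Fin d → ℝ} (hφ : Function.Injective φ) : α ≃ pointSet φ :=
  Equiv.ofBijective (fun p => ⟨φ p, mem_pointSet.2 ⟨p, rfl⟩⟩)
    ⟨fun _ _ h => hφ (Subtype.ext_iff.1 h), fun y => by
      obtain ⟨p, hp⟩ := mem_pointSet.1 y.2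
      exact ⟨p, Subtype.ext hp⟩⟩

theorem coe_pointEquiv {φ : α → Fin d → ℝ} (hφ : Function.Injective φ) (p : α) :
    (pointEquiv hφ p : Fin d → ℝ) = φ p := rfl

theorem rangeCount_pointSet {φ : α → Fin d → ℝ} (hφ : Function.Injective φ) {U : Set ℤ}
    (R : Finset (Fin d → ℝ)) (x : pointSet φ → U) [DecidablePred fun p => φ p ∈ R] :
    rangeCount R x = ∑ p, if φ p ∈ R then ((x (pointEquiv hφ p) : ℤ) : ℝ) else 0 := by
  unfold rangeCount
  rw [← (pointEquiv hφ).sum_comp]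
  refine Finset.sum_congr rfl fun p _ => ?_
  by_cases h : φ p ∈ R
  · exact (if_pos ((coe_pointEquiv hφ p).symm ▸ h)).trans (if_pos h).symm
  · exact (if_neg ((coe_pointEquiv hφ p).symm ▸ h)).trans (if_neg h).symm

variable [Lattice α]

/-- The image under `φ` of the interval `[l, u]`. -/
noncomputable def intervalImage (l u : α) : Finset (Fin d → ℝ) :=
  open Classical in (Finset.univ.filter fun p => l ≤ p ∧ p ≤ u).image φ

theorem mem_intervalImage {φ : α → Fin d → ℝ} (hφ : Function.Injective φ) {l u p : α} :
    φ p ∈ intervalImage φ l u ↔ l ≤ p ∧ p ≤ u := by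
  classical
  simp [intervalImage, hφ.eq_iff]

theorem intervalImage_inj {φ : α → Fin d → ℝ} (hφ : Function.Injective φ) {l u l' u' : α}
    (h : l ≤ u) (h' : l' ≤ u') (he : intervalImage φ l u = intervalImage φ l' u') :
    l = l' ∧ u = u' := by
  have key : ∀ p, (l ≤ p ∧ p ≤ u) ↔ (l' ≤ p ∧ p ≤ u') := fun p => by
    rw [← mem_intervalImage hφ, he, mem_intervalImage hφ]
  have h₁ := (key l).1 ⟨le_rfl, h⟩
  have h₂ := (key u).1 ⟨h, le_rfl⟩
  have h₃ := (key l').2 ⟨le_rfl, h'⟩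
  have h₄ := (key u').2 ⟨h', le_rfl⟩
  exact ⟨le_antisymm h₃.1 h₁.1, le_antisymm h₂.2 h₄.2⟩

theorem intervalImage_mem_orthogonalRanges {φ : α → Fin d → ℝ} (hφ : ∀ p q, φ p ≤ φ q ↔ p ≤ q)
    (l u : α) : intervalImage φ l u ∈ orthogonalRanges (pointSet φ) := by
  classical
  unfold orthogonalRanges
  rw [Finset.mem_filter, Finset.mem_powerset]
  refine ⟨?_, φ l, φ u, ?_⟩
  · intro x hx
    obtain ⟨p, -, rfl⟩ := Finset.mem_image.1 hx
    exact mem_pointSet.2 ⟨p, rfl⟩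
  · ext x
    simp only [intervalImage, Finset.coe_image, Finset.coe_filter, Finset.mem_univ, true_and,
      Set.mem_image, Set.mem_ofPred_eq, Set.mem_inter_iff, Set.mem_Icc, Finset.mem_coe,
      mem_pointSet]
    constructor
    · rintro ⟨p, hp, rfl⟩
      exact ⟨⟨(hφ _ _).2 hp.1, (hφ _ _).2 hp.2⟩, p, rfl⟩
    · rintro ⟨hx, p, rfl⟩
      exact ⟨p, ⟨(hφ _ _).1 hx.1, (hφ _ _).1 hx.2⟩, rfl⟩

/-- The preimage of a box under a lattice homomorphism is closed under meets and joins, so when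
nonempty it contains its own least and greatest elements. -/
theorem exists_intervalImage_of_mem_orthogonalRanges {φ : α → Fin d → ℝ}
    (hinf : ∀ p q, φ (p ⊓ q) = φ p ⊓ φ q) (hsup : ∀ p q, φ (p ⊔ q) = φ p ⊔ φ q)
    {R : Finset (Fin d → ℝ)}
    (hR : R ∈ orthogonalRanges (pointSet φ)) (hne : R.Nonempty) :
    ∃ l u, l ≤ u ∧ R = intervalImage φ l u := by
  classical
  have hmono : Monotone φ := fun p q hpq => by
    rw [← inf_eq_left, ← hinf, inf_eq_left.2 hpq]
  unfold orthogonalRanges at hR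
  rw [Finset.mem_filter, Finset.mem_powerset] at hR
  obtain ⟨-, a, b, hab⟩ := hR
  let S : Finset α := Finset.univ.filter fun p => a ≤ φ p ∧ φ p ≤ b
  have hRS : R = S.image φ := by
    rw [← Finset.coe_inj, hab]
    ext x
    simp only [S, Finset.coe_image, Finset.coe_filter, Finset.mem_univ, true_and,
      Set.mem_image, Set.mem_ofPred_eq, Set.mem_inter_iff, Set.mem_Icc, Finset.mem_coe,
      mem_pointSet]
    constructor
    · rintro ⟨hx, p, rfl⟩
      exact ⟨p, hx, rfl⟩
    · rintro ⟨p, hp, rfl⟩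
      exact ⟨hp, p, rfl⟩
  have hS : S.Nonempty := by
    rw [hRS] at hne
    exact Finset.image_nonempty.1 hne
  have hl : S.inf' hS id ∈ (S : Set α) := by
    refine Finset.inf'_mem (S : Set α) ?_ _ _ _ fun i hi => hi
    intro p hp q hq
    simp only [S, Finset.coe_filter, Finset.mem_univ, true_and, Set.mem_ofPred_eq] at hp hq ⊢
    rw [hinf]
    exact ⟨le_inf hp.1 hq.1, inf_le_left.trans hp.2⟩
  have hu : S.sup' hS id ∈ (S : Set α) := by
    refine Finset.sup'_mem (S : Set α) ?_ _ _ _ fun i hi => hi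
    intro p hp q hq
    simp only [S, Finset.coe_filter, Finset.mem_univ, true_and, Set.mem_ofPred_eq] at hp hq ⊢
    rw [hsup]
    exact ⟨hp.1.trans le_sup_left, sup_le hp.2 hq.2⟩
  refine ⟨S.inf' hS id, S.sup' hS id, Finset.inf'_le id hu, ?_⟩
  rw [hRS]
  have hIcc : ∀ p, p ∈ S ↔ S.inf' hS id ≤ p ∧ p ≤ S.sup' hS id := by
    refine fun p => ⟨fun hp => ⟨Finset.inf'_le id hp, Finset.le_sup' id hp⟩, fun h => ?_⟩
    have hl' := (Finset.mem_filter.1 (Finset.mem_coe.1 hl)).2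
    have hu' := (Finset.mem_filter.1 (Finset.mem_coe.1 hu)).2
    exact Finset.mem_filter.2
      ⟨Finset.mem_univ _, hl'.1.trans (hmono h.1), (hmono h.2).trans hu'.2⟩
  ext x
  simp only [intervalImage, Finset.mem_image, Finset.mem_filter, Finset.mem_univ, true_and, hIcc]

theorem card_orthogonalRanges_image_le {φ : α → Fin d → ℝ}
    (hinf : ∀ p q, φ (p ⊓ q) = φ p ⊓ φ q) (hsup : ∀ p q, φ (p ⊔ q) = φ p ⊔ φ q) :
    (orthogonalRanges (pointSet φ)).card ≤ Nat.card {x : α × α // x.1 ≤ x.2} + 1 := by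
  classical
  have : orthogonalRanges (pointSet φ) ⊆
      insert ∅ ((Finset.univ.filter fun x : α × α => x.1 ≤ x.2).image
        fun x => intervalImage φ x.1 x.2) := by
    intro R hR
    rcases R.eq_empty_or_nonempty with rfl | hne
    · simp
    · obtain ⟨l, u, hlu, rfl⟩ := exists_intervalImage_of_mem_orthogonalRanges hinf hsup hR hne
      refine Finset.mem_insert_of_mem (Finset.mem_image.2 ⟨(l, u), ?_, rfl⟩)
      simpa using hlu
  refine (Finset.card_le_card this).trans ((Finset.card_insert_le _ _).trans ?_)
  gcongr
  rw [Nat.card_eq_fintype_card, Fintype.card_subtype]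
  exact Finset.card_image_le

/-- Pairs with `l ≤ u` give distinct ranges, and all other pairs contribute 0 to `boxSumSq`. -/
theorem boxSumSq_le_sum_orthogonalRanges {φ : α → Fin d → ℝ} (hφ : ∀ p q, φ p ≤ φ q ↔ p ≤ q)
    (z : α → ℝ) [∀ R : Finset (Fin d → ℝ), DecidablePred fun p => φ p ∈ R] :
    boxSumSq z ≤ ∑ R : orthogonalRanges (pointSet φ),
      (∑ p, if φ p ∈ (R : Finset (Fin d → ℝ)) then z p else 0) ^ 2 := by
  classical
  have hinj : Function.Injective φ := fun p q h =>
    le_antisymm ((hφ p q).1 h.le) ((hφ q p).1 h.ge)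
  rw [Finset.sum_coe_sort (orthogonalRanges (pointSet φ))
    (fun R => (∑ p, if φ p ∈ R then z p else 0) ^ 2)]
  let T := (Finset.univ.filter fun x : α × α => x.1 ≤ x.2)
  have hT : T.image (fun x => intervalImage φ x.1 x.2) ⊆
      orthogonalRanges (pointSet φ) := by
    intro R hR
    obtain ⟨x, -, rfl⟩ := Finset.mem_image.1 hR
    exact intervalImage_mem_orthogonalRanges hφ _ _
  refine le_trans (le_of_eq ?_)
    (Finset.sum_le_sum_of_subset_of_nonneg hT fun _ _ _ => sq_nonneg _)
  rw [Finset.sum_image]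
  · simp only [mem_intervalImage hinj]
    rw [Finset.sum_filter, Fintype.sum_prod_type]
    unfold boxSumSq
    refine Finset.sum_congr rfl fun l _ => Finset.sum_congr rfl fun u _ => ?_
    split_ifs with h
    · congr!
    · rw [Finset.sum_eq_zero, zero_pow two_ne_zero]
      intro p _
      exact if_neg fun hp => h (hp.1.trans hp.2)
  · intro x hx y hy hxy
    simp only [T, Finset.coe_filter, Finset.mem_univ, true_and, Set.mem_ofPred_eq] at hx hy
    obtain ⟨h₁, h₂⟩ := intervalImage_inj hinj hx hy hxy
    exact Prod.ext h₁ h₂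

end Lattice

/-! ### Counting intervals and embedding the grid -/

theorem card_le_pairs_cube (m : ℕ) :
    Nat.card {x : (Fin m → Bool) × (Fin m → Bool) // x.1 ≤ x.2} ≤ 3 ^ m := by
  have h3 : Nat.card {y : Bool × Bool // y.1 ≤ y.2} = 3 := by
    rw [Nat.card_eq_fintype_card]
    decide
  have : Nat.card (Fin m → {y : Bool × Bool // y.1 ≤ y.2}) = 3 ^ m := by
    rw [Nat.card_fun, h3, Nat.card_fin]
  rw [← this]
  refine Nat.card_le_card_of_injective
    (fun x => fun i => ⟨(x.1.1 i, x.1.2 i), x.2 i⟩) ?_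
  rintro ⟨⟨a, b⟩, hx⟩ ⟨⟨a', b'⟩, hy⟩ h
  have h' := fun i => congrFun h i
  simp only [Subtype.mk.injEq, Prod.mk.injEq] at h' ⊢
  exact ⟨funext fun i => (h' i).1, funext fun i => (h' i).2⟩

theorem card_le_pairs_cube_prod_line (m t : ℕ) :
    Nat.card {x : ((Fin m → Bool) × Fin t) × ((Fin m → Bool) × Fin t) // x.1 ≤ x.2} ≤
      3 ^ m * t ^ 2 := by
  have : Nat.card ({x : (Fin m → Bool) × (Fin m → Bool) // x.1 ≤ x.2} × (Fin t × Fin t)) ≤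
      3 ^ m * t ^ 2 := by
    rw [Nat.card_prod, Nat.card_prod, Nat.card_fin, sq]
    gcongr
    exact card_le_pairs_cube m
  refine le_trans (Nat.card_le_card_of_injective
    (fun x => (⟨(x.1.1.1, x.1.2.1), x.2.1⟩, (x.1.1.2, x.1.2.2))) ?_) this
  rintro ⟨⟨⟨a, s⟩, ⟨b, r⟩⟩, hx⟩ ⟨⟨⟨a', s'⟩, ⟨b', r'⟩⟩, hy⟩ h
  simp only [Subtype.mk.injEq, Prod.mk.injEq] at h ⊢
  tauto

/-- The cube times a line, placed in the first `m + 1` coordinates of `ℝᵈ`. -/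
def gridEmbedding (m t d : ℕ) (p : (Fin m → Bool) × Fin t) : Fin d → ℝ := fun i =>
  if h : (i : ℕ) < m then (if p.1 ⟨i, h⟩ then 1 else 0)
  else if (i : ℕ) = m then ((p.2 : ℕ) : ℝ) else 0

theorem gridEmbedding_inf (m t d : ℕ) (p q : (Fin m → Bool) × Fin t) :
    gridEmbedding m t d (p ⊓ q) = gridEmbedding m t d p ⊓ gridEmbedding m t d q := by
  ext i
  simp only [gridEmbedding, Pi.inf_apply, Prod.fst_inf, Prod.snd_inf]
  split_ifs with h₁ h₂ h₃ h₄ h₅ h₆ h₇ <;> simp_all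

theorem gridEmbedding_sup (m t d : ℕ) (p q : (Fin m → Bool) × Fin t) :
    gridEmbedding m t d (p ⊔ q) = gridEmbedding m t d p ⊔ gridEmbedding m t d q := by
  ext i
  simp only [gridEmbedding, Pi.sup_apply, Prod.fst_sup, Prod.snd_sup]
  split_ifs with h₁ h₂ h₃ h₄ h₅ h₆ h₇ <;> simp_all

theorem gridEmbedding_injective {m t d : ℕ} (hd : m < d) :
    Function.Injective (gridEmbedding m t d) := by
  rintro ⟨p, s⟩ ⟨q, r⟩ h
  refine Prod.ext (funext fun i => ?_) (Fin.ext ?_)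
  · have := congrFun h ⟨i, i.2.trans hd⟩
    simp only [gridEmbedding, i.2, dif_pos] at this
    rcases hp : p i <;> rcases hq : q i <;> simp_all
  · have := congrFun h ⟨m, hd⟩
    simpa [gridEmbedding] using this

theorem gridEmbedding_le_iff {m t d : ℕ} (hd : m < d) (p q : (Fin m → Bool) × Fin t) :
    gridEmbedding m t d p ≤ gridEmbedding m t d q ↔ p ≤ q := by
  rw [← inf_eq_left, ← gridEmbedding_inf, (gridEmbedding_injective hd).eq_iff, inf_eq_left]

/-! ### Reconstruction against differential privacy -/

section Reconstruction

theorem sum_measureReal_inter_eq_integral {J Y : Type*} [Fintype J] [MeasurableSpace Y] (μ : Measure Y) [IsFiniteMeasure μ] (f : Y → J → Bool)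
    (hf : ∀ A, MeasurableSet (f ⁻¹' A)) (G : Set Y) (A : J → Set (J → Bool)) :
    ∑ i, μ.real (G ∩ f ⁻¹' A i) =
      ∫ y in G, ∑ i, (f ⁻¹' A i).indicator (fun _ => (1 : ℝ)) y ∂μ := by
  rw [integral_finsetSum _ fun i _ => (integrable_const _).indicator (hf _)]
  refine Finset.sum_congr rfl fun i _ => ?_
  rw [integral_indicator (hf _)]
  simp [measureReal_restrict_apply (hf _), Set.inter_comm]

variable {J Y : Type*} [DecidableEq J] [MeasurableSpace Y]

/-- Flip the `i`-th bit. -/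
def flipBit (T : J → Bool) (i : J) : J → Bool := Function.update T i (!T i)

theorem flipBit_flipBit (T : J → Bool) (i : J) : flipBit (flipBit T i) i = T := by
  simp [flipBit]

variable [Fintype J]

theorem hammingDist_flipBit_le (T : J → Bool) (i : J) : hammingDist (flipBit T i) T ≤ 1 := by
  unfold hammingDist
  refine (Finset.card_le_card (t := {i}) ?_).trans (Finset.card_singleton i).le
  intro j hj
  by_contra h
  rw [Finset.mem_singleton] at h
  exact (Finset.mem_filter.1 hj).2 (Function.update_of_ne h _ _)

/-- The decoder depends on `y` only through the finite pattern of the `G T` containing it, hence is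
measurable. -/
theorem exists_measurable_selection (G : (J → Bool) → Set Y) (hG : ∀ T, MeasurableSet (G T)) :
    ∃ f : Y → J → Bool, (∀ y T, y ∈ G T → y ∈ G (f y)) ∧ ∀ A, MeasurableSet (f ⁻¹' A) := by
  classical
  let pat : Y → (J → Bool) → Prop := fun y T => y ∈ G T
  have hpat : Measurable pat := measurable_pi_lambda _ fun T => measurable_mem.2 (hG T)
  let sel : ((J → Bool) → Prop) → J → Bool := fun Q => if h : ∃ T, Q T then h.choose else default
  refine ⟨fun y => sel (pat y), ?_, ?_⟩
  · intro y T hy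
    have h : ∃ T, pat y T := ⟨T, hy⟩
    have : sel (pat y) = h.choose := dif_pos h
    change y ∈ G (sel (pat y))
    rw [this]
    exact h.choose_spec
  · intro A
    exact hpat ((sel ⁻¹' A).to_countable.measurableSet)

/-- If the sets `G T` of outputs that are accurate for the input `T` have diameter at most `D` in
the sense that only inputs at Hamming distance `≤ D` share an output, then a private family of laws
which puts mass `≥ γ` on the accurate outputs has to satisfy this inequality. -/
theorem reconstruction_bound (μ : (J → Bool) → Measure Y) [∀ T, IsProbabilityMeasure (μ T)]
    {ε δ γ D : ℝ}
    (hpriv : ∀ T i S, MeasurableSet S →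
      (μ T).real S ≤ Real.exp ε * (μ (flipBit T i)).real S + δ)
    (G : (J → Bool) → Set Y) (hG : ∀ T, MeasurableSet (G T)) (hγ : ∀ T, γ ≤ (μ T).real (G T))
    (hD : ∀ T T' y, y ∈ G T → y ∈ G T' → (hammingDist T T' : ℝ) ≤ D)
    (hD₀ : 0 ≤ D) (hDJ : D ≤ Fintype.card J) :
    (Fintype.card J - D) * γ ≤ Real.exp ε * (D + 1) + δ * Fintype.card J := by
  classical
  obtain ⟨f, hfG, hf⟩ := exists_measurable_selection G hG
  -- The event that the output is accurate for `T` and the decoder gets bit `i` right. Under `T`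
  -- these events have large total mass; flipping bit `i` of the input turns the right guess into a
  -- wrong one, and few guesses are wrong.
  let S : (J → Bool) → J → Set Y := fun T i => G T ∩ f ⁻¹' {v | v i = T i}
  have hS : ∀ T i, MeasurableSet (S T i) := fun T i => (hG T).inter (hf _)
  have hlow : ∀ T, (Fintype.card J - D) * γ ≤ ∑ i, (μ T).real (S T i) := by
    intro T
    rw [sum_measureReal_inter_eq_integral (μ T) f hf (G T) (fun i => {v | v i = T i})]
    calc (Fintype.card J - D) * γ ≤ (Fintype.card J - D) * (μ T).real (G T) :=
          mul_le_mul_of_nonneg_left (hγ T) (by linarith)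
      _ = ∫ y in G T, ((Fintype.card J : ℝ) - D) ∂(μ T) := by
          simp [mul_comm]
      _ ≤ _ := by
          refine setIntegral_mono_on (integrable_const _)
            (integrable_finsetSum _ fun i _ => (integrable_const _).indicator (hf _)) (hG T) ?_
          intro y hy
          have h₁ := hD (f y) T y (hfG y T hy) hy
          have h₂ : (∑ i, (f ⁻¹' {v | v i = T i}).indicator (fun _ => (1 : ℝ)) y) +
              hammingDist (f y) T = Fintype.card J := by
            simp only [hammingDist, Set.indicator_apply, Set.mem_preimage, Set.mem_ofPred_eq,
              Finset.sum_boole]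
            rw [← Nat.cast_add, Finset.card_filter_add_card_filter_not, Finset.card_univ]
          linarith
  have hup : ∀ T, ∑ i, (μ T).real (S (flipBit T i) i) ≤ D + 1 := by
    intro T
    -- `H` replaces the sets `G (flipBit T i)`, which vary with `i`; the extra 1 is the flipped bit.
    let H : Set Y := f ⁻¹' {v | (hammingDist v T : ℝ) ≤ D + 1}
    have hH : MeasurableSet H := hf _
    have hsub : ∀ i, S (flipBit T i) i ⊆ H ∩ f ⁻¹' {v | v i ≠ T i} := by
      rintro i y ⟨hy, hyi⟩
      refine ⟨?_, ?_⟩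
      · have h₁ := hD (f y) (flipBit T i) y (hfG y _ hy) hy
        have h₂ := hammingDist_triangle (f y) (flipBit T i) T
        have h₃ := hammingDist_flipBit_le T i
        have : (hammingDist (f y) T : ℝ) ≤ hammingDist (f y) (flipBit T i) + 1 := by
          exact_mod_cast h₂.trans (by omega)
        simp only [H, Set.mem_preimage, Set.mem_ofPred_eq]
        linarith
      · simp only [Set.mem_preimage, Set.mem_ofPred_eq] at hyi ⊢
        rw [hyi]
        simp [flipBit]
    calc ∑ i, (μ T).real (S (flipBit T i) i)
        ≤ ∑ i, (μ T).real (H ∩ f ⁻¹' {v | v i ≠ T i}) :=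
          Finset.sum_le_sum fun i _ => measureReal_mono (hsub i)
      _ = ∫ y in H, ∑ i, (f ⁻¹' {v | v i ≠ T i}).indicator (fun _ => (1 : ℝ)) y ∂(μ T) :=
          sum_measureReal_inter_eq_integral (μ T) f hf H (fun i => {v | v i ≠ T i})
      _ ≤ ∫ y in H, (D + 1) ∂(μ T) := by
          refine setIntegral_mono_on
            (integrable_finsetSum _ fun i _ => (integrable_const _).indicator (hf _))
            (integrable_const _) hH ?_
          intro y hy
          have : (∑ i, (f ⁻¹' {v | v i ≠ T i}).indicator (fun _ => (1 : ℝ)) y) =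
              hammingDist (f y) T := by
            simp only [hammingDist, Set.indicator_apply, Set.mem_preimage, Set.mem_ofPred_eq,
              Finset.sum_boole]
          rw [this]
          exact hy
      _ = (μ T).real H * (D + 1) := by simp
      _ ≤ 1 * (D + 1) := by
          gcongr
          exact measureReal_le_one
      _ = D + 1 := one_mul _
  have hcard : (0 : ℝ) < Fintype.card (J → Bool) := by exact_mod_cast Fintype.card_pos
  -- Summing over all inputs allows `T` to be exchanged with `flipBit T i`.
  have hflip : ∑ T, ∑ i, (μ (flipBit T i)).real (S T i) =
      ∑ T, ∑ i, (μ T).real (S (flipBit T i) i) := by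
    rw [Finset.sum_comm]
    conv_rhs => rw [Finset.sum_comm]
    refine Finset.sum_congr rfl fun i _ => ?_
    refine Fintype.sum_bijective (fun T => flipBit T i)
      (Function.Involutive.bijective fun T => flipBit_flipBit T i) _ _ fun T => ?_
    rw [flipBit_flipBit]
  have h₁ : Fintype.card (J → Bool) * ((Fintype.card J - D) * γ) ≤
      ∑ T, ∑ i, (μ T).real (S T i) := by
    rw [← nsmul_eq_mul, ← Finset.card_univ, ← Finset.sum_const]
    exact Finset.sum_le_sum fun T _ => hlow T
  have h₂ : ∑ T, ∑ i, (μ T).real (S T i) ≤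
      Real.exp ε * ∑ T, ∑ i, (μ T).real (S (flipBit T i) i) +
        Fintype.card (J → Bool) * (δ * Fintype.card J) := by
    rw [← hflip]
    calc ∑ T, ∑ i, (μ T).real (S T i)
        ≤ ∑ T, ∑ i, (Real.exp ε * (μ (flipBit T i)).real (S T i) + δ) :=
          Finset.sum_le_sum fun T _ => Finset.sum_le_sum fun i _ => hpriv T i _ (hS T i)
      _ = _ := by
          simp only [Finset.sum_add_distrib, Finset.mul_sum, Finset.sum_const, nsmul_eq_mul,
            Finset.card_univ]
          ring
  have h₃ : ∑ T, ∑ i, (μ T).real (S (flipBit T i) i) ≤ Fintype.card (J → Bool) * (D + 1) := by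
    rw [← nsmul_eq_mul, ← Finset.card_univ, ← Finset.sum_const]
    exact Finset.sum_le_sum fun T _ => hup T
  have h₄ := mul_le_mul_of_nonneg_left h₃ (Real.exp_pos ε).le
  refine le_of_mul_le_mul_left ?_ hcard
  linarith

end Reconstruction
-- Bit vectors as weights on the grid
/-- The points of the cube times a line whose weights are not fixed to be zero. -/
abbrev EvenPoint (m t : ℕ) : Type := {p : Fin m → Bool // paritySign p = 1} × Fin t

theorem two_mul_card_evenPoint {m : ℕ} (hm : 0 < m) (t : ℕ) [Fintype (EvenPoint m t)] :
    2 * Fintype.card (EvenPoint m t) = 2 ^ m * t := by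
  rw [← Nat.card_eq_fintype_card, Nat.card_prod, Nat.card_fin, ← mul_assoc,
    card_paritySign_eq_one hm]

/-- The extension by zero of a bit vector to the cube times a line. -/
noncomputable def extendBits {m t : ℕ} (T : EvenPoint m t → Bool)
    (p : (Fin m → Bool) × Fin t) : Bool :=
  open Classical in if h : paritySign p.1 = 1 then T (⟨p.1, h⟩, p.2) else false

theorem extendBits_eq_false {m t : ℕ} (T : EvenPoint m t → Bool) {p : (Fin m → Bool) × Fin t}
    (hp : paritySign p.1 ≠ 1) : extendBits T p = false := by
  simp [extendBits, hp]

theorem sum_extendBits {m t : ℕ} [Fintype (EvenPoint m t)] (T T' : EvenPoint m t → Bool)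
    {A : Type*} [AddCommMonoidWithOne A] (f : Bool → Bool → A) (hf : ∀ b, f b b = 0)
    (hf' : ∀ b, f b (!b) = 1) :
    ∑ p, f (extendBits T p) (extendBits T' p) = hammingDist T T' := by
  have : ((hammingDist T T' : ℕ) : A) = ∑ j, f (T j) (T' j) := by
    unfold hammingDist
    rw [← Finset.sum_boole]
    refine Finset.sum_congr rfl fun j _ => ?_
    rcases h : T j <;> rcases h' : T' j <;> simp [hf]
    · exact (hf' false).symm
    · exact (hf' true).symm
  rw [this]
  symm
  refine Fintype.sum_of_injective (fun j : EvenPoint m t => (j.1.1, j.2)) ?_ _ _ ?_ ?_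
  · rintro ⟨⟨p, hp⟩, s⟩ ⟨⟨q, hq⟩, r⟩ h
    simp only [Prod.mk.injEq, Subtype.mk.injEq] at h ⊢
    exact h
  · intro p hp
    have : paritySign p.1 ≠ 1 := fun h => hp ⟨(⟨p.1, h⟩, p.2), rfl⟩
    rw [extendBits_eq_false T this, extendBits_eq_false T' this, hf]
  · rintro ⟨⟨p, hp⟩, s⟩
    simp [extendBits, hp]

section Weights

variable {m t d : ℕ} (hd : m < d) {U : Set ℤ} (hU₀ : (0 : ℤ) ∈ U) (hU₁ : (1 : ℤ) ∈ U)

/-- The weights on the grid which are given by a bit vector. -/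
noncomputable def gridWeights (T : EvenPoint m t → Bool)
    (y : pointSet (gridEmbedding m t d)) : U :=
  if extendBits T ((pointEquiv (gridEmbedding_injective hd)).symm y) then ⟨1, hU₁⟩ else ⟨0, hU₀⟩

theorem coe_gridWeights (T : EvenPoint m t → Bool) (p : (Fin m → Bool) × Fin t) :
    (gridWeights hd hU₀ hU₁ T (pointEquiv (gridEmbedding_injective hd) p) : ℤ) =
      if extendBits T p then 1 else 0 := by
  unfold gridWeights
  rw [Equiv.symm_apply_apply]
  split_ifs <;> rfl

theorem sum_abs_gridWeights_sub [Fintype (EvenPoint m t)] (T T' : EvenPoint m t → Bool) :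
    ∑ y, |(gridWeights hd hU₀ hU₁ T y : ℤ) - gridWeights hd hU₀ hU₁ T' y| =
      hammingDist T T' := by
  rw [← (pointEquiv (gridEmbedding_injective hd)).sum_comp]
  simp only [coe_gridWeights]
  exact sum_extendBits T T' (fun b b' : Bool => |(if b then (1 : ℤ) else 0) - if b' then 1 else 0|)
    (by simp) (by simp)

theorem card_pointSet_gridEmbedding (hd : m < d) :
    (pointSet (gridEmbedding m t d)).card = 2 ^ m * t := by
  rw [← Fintype.card_coe, ← Fintype.card_congr (pointEquiv (gridEmbedding_injective hd))]
  simp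

theorem hammingDist_le_sum_rangeCount [Fintype (EvenPoint m t)] (T T' : EvenPoint m t → Bool) :
    t * (√3 ^ m * hammingDist T T') ≤ 8 * ∑ R : orthogonalRanges (pointSet (gridEmbedding m t d)),
      (rangeCount (R : Finset (Fin d → ℝ)) (gridWeights hd hU₀ hU₁ T) -
        rangeCount (R : Finset (Fin d → ℝ)) (gridWeights hd hU₀ hU₁ T')) ^ 2 := by
  classical
  let w : (EvenPoint m t → Bool) → (Fin m → Bool) × Fin t → ℝ :=
    fun T p => if extendBits T p then 1 else 0
  have hR : ∀ (R : Finset (Fin d → ℝ)) T, rangeCount R (gridWeights hd hU₀ hU₁ T) =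
      ∑ p, if gridEmbedding m t d p ∈ R then w T p else 0 := by
    intro R T
    rw [rangeCount_pointSet (gridEmbedding_injective hd)]
    simp only [coe_gridWeights, w]
    push_cast
    rfl
  have h₁ := boxSumSq_cube_prod_line (fun p => w T p - w T' p) fun p hp => by
    simp [w, extendBits_eq_false _ hp]
  have h₂ := boxSumSq_le_sum_orthogonalRanges (gridEmbedding_le_iff hd)
    (fun p => w T p - w T' p)
  have h₃ : ∑ p, (w T p - w T' p) ^ 2 = hammingDist T T' :=
    sum_extendBits T T'
      (fun b b' : Bool => ((if b then (1 : ℝ) else 0) - if b' then 1 else 0) ^ 2)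
      (by simp) (by simp)
  rw [h₃] at h₁
  refine h₁.trans (mul_le_mul_of_nonneg_left (h₂.trans (le_of_eq ?_)) (by norm_num))
  refine Finset.sum_congr rfl fun R _ => ?_
  rw [hR, hR, ← Finset.sum_sub_distrib]
  congr 1
  refine Finset.sum_congr rfl fun p _ => ?_
  split_ifs <;> simp

theorem card_orthogonalRanges_grid_le (ht : 0 < t) :
    ((orthogonalRanges (pointSet (gridEmbedding m t d))).card : ℝ) ≤
      2 * (√3 ^ m * √3 ^ m * t ^ 2) := by
  have h₁ := (card_orthogonalRanges_image_le (gridEmbedding_inf m t d)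
    (gridEmbedding_sup m t d)).trans (Nat.add_le_add_right (card_le_pairs_cube_prod_line m t) 1)
  -- The empty range, counted by the `+ 1`, is absorbed by doubling.
  have h₂ : 1 ≤ 3 ^ m * t ^ 2 := Nat.succ_le_of_lt (by positivity)
  have h₃ : (orthogonalRanges (pointSet (gridEmbedding m t d))).card ≤ 2 * (3 ^ m * t ^ 2) := by
    omega
  rw [← mul_pow, Real.mul_self_sqrt (by norm_num)]
  exact_mod_cast h₃

/-- The constant is `64 = 8 * 4 * 2`: 8 from the line, 4 from comparing both count vectors with `y`,
2 from the number of ranges. -/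
theorem hammingDist_le_of_avgSquaredError_le [Fintype (EvenPoint m t)] (ht : 0 < t) {E : ℝ}
    (T T' : EvenPoint m t → Bool) (y : orthogonalRanges (pointSet (gridEmbedding m t d)) → ℝ)
    (hT : avgSquaredError (gridWeights hd hU₀ hU₁ T) y ≤ E)
    (hT' : avgSquaredError (gridWeights hd hU₀ hU₁ T') y ≤ E) :
    (hammingDist T T' : ℝ) ≤ 64 * E * √3 ^ m * t := by
  have hcard : (0 : ℝ) < (orthogonalRanges (pointSet (gridEmbedding m t d))).card := by
    have := intervalImage_mem_orthogonalRanges (gridEmbedding_le_iff (t := t) hd)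
      (fun _ => false, ⟨0, ht⟩) (fun _ => false, ⟨0, ht⟩)
    exact_mod_cast Finset.card_pos.2 ⟨_, this⟩
  have hE : 0 ≤ E := le_trans (by unfold avgSquaredError; positivity) hT
  unfold avgSquaredError at hT hT'
  rw [div_le_iff₀ hcard] at hT hT'
  have h := hammingDist_le_sum_rangeCount hd hU₀ hU₁ T T'
  have hsum : ∑ R : orthogonalRanges (pointSet (gridEmbedding m t d)),
      (rangeCount (R : Finset (Fin d → ℝ)) (gridWeights hd hU₀ hU₁ T) -
        rangeCount (R : Finset (Fin d → ℝ)) (gridWeights hd hU₀ hU₁ T')) ^ 2 ≤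
      2 * ∑ R : orthogonalRanges (pointSet (gridEmbedding m t d)),
        (y R - rangeCount (R : Finset (Fin d → ℝ)) (gridWeights hd hU₀ hU₁ T)) ^ 2 +
      2 * ∑ R : orthogonalRanges (pointSet (gridEmbedding m t d)),
        (y R - rangeCount (R : Finset (Fin d → ℝ)) (gridWeights hd hU₀ hU₁ T')) ^ 2 := by
    rw [Finset.mul_sum, Finset.mul_sum, ← Finset.sum_add_distrib]
    refine Finset.sum_le_sum fun R _ => ?_
    set a := rangeCount (R : Finset (Fin d → ℝ)) (gridWeights hd hU₀ hU₁ T)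
    set b := rangeCount (R : Finset (Fin d → ℝ)) (gridWeights hd hU₀ hU₁ T')
    nlinarith [sq_nonneg ((y R - a) + (y R - b))]
  have hc := mul_le_mul_of_nonneg_left (card_orthogonalRanges_grid_le (m := m) (d := d) ht) hE
  have hpos : (0 : ℝ) < t * √3 ^ m := by positivity
  refine le_of_mul_le_mul_left ?_ hpos
  linarith

theorem measurableSet_avgSquaredError_le {P : Finset (Fin d → ℝ)} (x : P → U) (E : ℝ) :
    MeasurableSet {y : orthogonalRanges P → ℝ | avgSquaredError x y ≤ E} := by
  refine measurableSet_le ?_ measurable_const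
  unfold avgSquaredError
  fun_prop

/-- What privacy and accuracy `E` on the grid imply for the parameters. -/
theorem grid_reconstruction_bound (hd : m < d) (hU₀ : (0 : ℤ) ∈ U) (hU₁ : (1 : ℤ) ∈ U) (hm : 0 < m)
    (ht : 0 < t) {ε δ γ E D : ℝ}
    (M : (pointSet (gridEmbedding m t d) → U) →
      ProbabilityMeasure (orthogonalRanges (pointSet (gridEmbedding m t d)) → ℝ))
    (hpriv : IsDifferentiallyPrivate M ε δ)
    (hM : ∀ x, γ ≤ (M x : Measure _).real {y | avgSquaredError x y ≤ E})
    (hD : 64 * E * √3 ^ m * t ≤ D) (hD₀ : 0 ≤ D) (hDN : 2 * D ≤ 2 ^ m * t) :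
    (2 ^ m * t - 2 * D) * γ ≤ Real.exp ε * (2 * D + 2) + δ * (2 ^ m * t) := by
  classical
  have hN : 2 * (Fintype.card (EvenPoint m t) : ℝ) = 2 ^ m * t := by
    exact_mod_cast two_mul_card_evenPoint hm t
  have h := reconstruction_bound (J := EvenPoint m t) (ε := ε) (δ := δ) (γ := γ) (D := D)
    (fun T => (M (gridWeights hd hU₀ hU₁ T) : Measure _))
    (fun T i S hS => hpriv _ _ (by
      rw [sum_abs_gridWeights_sub, hammingDist_comm]
      exact_mod_cast hammingDist_flipBit_le T i) S hS)
    (fun T => {y | avgSquaredError (gridWeights hd hU₀ hU₁ T) y ≤ E})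
    (fun T => measurableSet_avgSquaredError_le _ _) (fun T => hM _)
    (fun T T' y hy hy' =>
      (hammingDist_le_of_avgSquaredError_le hd hU₀ hU₁ ht T T' y hy hy').trans hD)
    hD₀ (by linarith)
  rw [← hN]
  linarith

end Weights

/-! ### Choice of parameters and conclusion -/

/-- After division by `2 ^ m * t` the second inequality tends to `δ < γ`, since `11 / 10 * √3 < 2`.
-/
theorem eventually_reconstruction_fails {γ ε δ : ℝ} (hδγ : δ < γ) :
    ∀ᶠ m : ℕ in atTop, ∀ t : ℕ, 0 < t →
      2 * (64 * (11 / 10 * √3) ^ m * (t : ℝ)) ≤ 2 ^ m * t ∧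
      Real.exp ε * (2 * (64 * (11 / 10 * √3) ^ m * t) + 2) + δ * (2 ^ m * t) <
        (2 ^ m * t - 2 * (64 * (11 / 10 * √3) ^ m * t)) * γ := by
  set q : ℝ := 11 / 20 * √3 with hq
  have hq₀ : 0 ≤ q := by positivity
  have hq₁ : q < 1 := by
    have : √3 < 20 / 11 := by
      rw [Real.sqrt_lt' (by norm_num)]
      norm_num
    rw [hq]
    linarith
  have hqm := tendsto_pow_atTop_nhds_zero_of_lt_one hq₀ hq₁
  have hhm := tendsto_pow_atTop_nhds_zero_of_lt_one (r := (1 / 2 : ℝ)) (by norm_num) (by norm_num)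
  have h₁ : ∀ᶠ m : ℕ in atTop, 128 * q ^ m < 1 :=
    ((hqm.const_mul 128).eventually (gt_mem_nhds (by norm_num)))
  have h₂ : ∀ᶠ m : ℕ in atTop,
      Real.exp ε * (128 * q ^ m + 2 * (1 / 2) ^ m) + δ < (1 - 128 * q ^ m) * γ := by
    have l₁ : Tendsto (fun m : ℕ => Real.exp ε * (128 * q ^ m + 2 * (1 / 2) ^ m) + δ) atTop
        (𝓝 (Real.exp ε * (128 * 0 + 2 * 0) + δ)) :=
      (((hqm.const_mul 128).add (hhm.const_mul 2)).const_mul _).add_const _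
    have l₂ : Tendsto (fun m : ℕ => (1 - 128 * q ^ m) * γ) atTop (𝓝 ((1 - 128 * 0) * γ)) :=
      ((hqm.const_mul 128).const_sub 1).mul_const γ
    exact l₁.eventually_lt l₂ (by simpa using hδγ)
  filter_upwards [h₁, h₂] with m h₁ h₂ t ht
  have ht' : (1 : ℝ) ≤ t := by exact_mod_cast ht
  have hpow : (11 / 10 * √3) ^ m = 2 ^ m * q ^ m := by
    rw [hq, ← mul_pow]
    congr 1
    ring
  have hhalf : (2 : ℝ) ^ m * (1 / 2) ^ m = 1 := by
    rw [← mul_pow]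
    norm_num
  have hpos : (0 : ℝ) < 2 ^ m * t := by positivity
  rw [hpow]
  constructor
  · nlinarith
  · have h₃ := mul_lt_mul_of_pos_left h₂ hpos
    have h₄ : 2 * Real.exp ε ≤ 2 ^ m * t * (Real.exp ε * (2 * (1 / 2) ^ m)) := by
      have : 2 ^ m * t * (Real.exp ε * (2 * (1 / 2) ^ m)) =
          2 * Real.exp ε * t * (2 ^ m * (1 / 2) ^ m) := by ring
      rw [this, hhalf, mul_one]
      exact le_mul_of_one_le_right (by positivity) ht'
    linarith

end PrivateRangeCounting

theorem mainTheorem8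
    (d : ℕ → ℕ) (hd : (fun n : ℕ => (d n : ℝ)) =Θ[atTop] fun n : ℕ => Real.log (n : ℝ))
    (g : ℕ → ℝ) (hg : Tendsto g atTop (𝓝 0))
    (γ ε δ : ℝ) (hε : 0 ≤ ε) (hδ : 0 ≤ δ) (hδγ : δ < γ)
    (U : Set ℤ) (hU₀ : (0 : ℤ) ∈ U) (hU₁ : (1 : ℤ) ∈ U)
    (M : PrivateRangeCounting.Mechanism U d)
    (hM : M.ApproximatesWithin (fun n : ℕ => (n : ℝ) ^ g n) γ) :
    ¬ M.IsPrivate ε δ := by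
  intro hpriv
  obtain ⟨C, hC, hCd⟩ := hd.2.exists_pos
  -- With `n = 2 ^ ((a + 1) * m)` and `log n ≤ C * d n`, this choice of `a` gives `2 * m ≤ d n`,
  -- leaving a coordinate for the line.
  obtain ⟨a, ha⟩ := exists_nat_ge (2 * C / Real.log 2)
  have hlog2 : 0 < Real.log 2 := Real.log_pos one_lt_two
  rw [div_le_iff₀ hlog2] at ha
  have hn : Tendsto (fun m : ℕ => 2 ^ m * 2 ^ (a * m)) atTop atTop :=
    tendsto_atTop_mono (fun m => Nat.le_mul_of_pos_right _ (by positivity))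
      (tendsto_pow_atTop_atTop_of_one_lt one_lt_two)
  have hlog : ∀ m : ℕ, Real.log ((2 ^ m * 2 ^ (a * m) : ℕ) : ℝ) = m * ((a + 1) * Real.log 2) := by
    intro m
    push_cast
    rw [← pow_add, Real.log_pow]
    push_cast
    ring
  have hgm : ∀ᶠ m : ℕ in atTop,
      (a + 1) * Real.log 2 * g (2 ^ m * 2 ^ (a * m)) < Real.log (11 / 10) := by
    have := (hg.comp hn).const_mul ((a + 1) * Real.log 2)
    rw [mul_zero] at this
    exact this.eventually (gt_mem_nhds (Real.log_pos (by norm_num)))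
  obtain ⟨m, hmpos, hfail, hCd, hM, hgm⟩ := ((eventually_gt_atTop 0).and
    ((PrivateRangeCounting.eventually_reconstruction_fails (ε := ε) hδγ).and
      ((hn.eventually hCd.bound).and ((hn.eventually hM).and hgm)))).exists
  have hmpos' : (1 : ℝ) ≤ m := by exact_mod_cast hmpos
  have ht : 0 < 2 ^ (a * m) := by positivity
  obtain ⟨hDN, hlt⟩ := hfail _ ht
  set n := 2 ^ m * 2 ^ (a * m) with hndef
  have hdim : m < d n := by
    rw [Real.norm_eq_abs, Real.norm_eq_abs, hlog m, abs_of_nonneg (by positivity),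
      abs_of_nonneg (by positivity)] at hCd
    have h₁ : C * (2 * m) ≤ C * d n := by nlinarith
    have h₂ : (2 * m : ℝ) ≤ d n := le_of_mul_le_mul_left h₁ hC
    have h₃ : 2 * m ≤ d n := by exact_mod_cast h₂
    omega
  -- As `log n` is a constant multiple of `m`, the error `n ^ g n` is `exp (o(m))`, below any fixed
  -- exponential with base above 1.
  have herr : (n : ℝ) ^ g n ≤ (11 / 10) ^ m := by
    have hn₀ : (0 : ℝ) < n := by positivity
    rw [Real.rpow_def_of_pos hn₀, hlog m,
      ← Real.exp_log (show (0 : ℝ) < (11 / 10) ^ m by positivity),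
      Real.log_pow, Real.exp_le_exp]
    nlinarith
  have hcard := PrivateRangeCounting.card_pointSet_gridEmbedding (t := 2 ^ (a * m)) hdim
  have hbound := PrivateRangeCounting.grid_reconstruction_bound hdim hU₀ hU₁ hmpos ht
    (D := 64 * (11 / 10 * √3) ^ m * ((2 ^ (a * m) : ℕ) : ℝ))
    (M n _) (hpriv n _ hcard) (hM _ hcard)
    (by rw [mul_pow, ← mul_assoc]; gcongr) (by positivity) hDN
  exact absurd hbound (not_le.2 hlt)
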